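/- Let $d,B$ be positive integers. An instance $\mathcal I$ of the $\{0,1\}$ $d$-dimensional online vector bin packing problem (OVBP) with bin size $B$ is a finite sequence of vectors of $\{0,1\}^d$, which arrive one by one. A (deterministic) online algorithm $\mathrm{ALG}$ irrevocably assigns every vector to a bin upon its arrival, knowing only the vectors that have arrived so far and their bins, such that at all times the vectors in each bin sum up to at most $(B,\dots,B)$. Let $\mathrm{ALG}(\mathcal I)$ be the number of bins that $\mathrm{ALG}$ uses, and $\mathrm{OPT}(\mathcal I)$ the least number of bins in a packing of $\mathcal I$ whose bins all satisfy this constraint; the competitive ratio of $\mathrm{ALG}$ on $\mathcal I$ is $\mathrm{ALG}(\mathcal I)/\mathrm{OPT}(\mathcal I)$. $\mathrm{FirstFit}$ puts each vector into the first opened bin that can accommodate it, and opens a new bin if there is none. Then: (1) For $B=1$ and every $d\ge 1$ there is an instance $\mathcal I$ with $\mathrm{OPT}(\mathcal I)=2$ and $$\frac{\mathrm{FirstFit}(\mathcal I)}{\mathrm{OPT}(\mathcal I)} > \frac{\sqrt{2d}-1}{4}.$$ (2) For $B=1$, every sufficiently large $d$ (at least an absolute constant $d_0$), and every online algorithm $\mathrm{ALG}$,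 there is an instance $\mathcal I$ with $\mathrm{OPT}(\mathcal I)\le \log_2(\sqrt{2d}+1)$ and $$\frac{\mathrm{ALG}(\mathcal I)}{\mathrm{OPT}(\mathcal I)} > \frac{2(\sqrt{2d}-1)}{\bigl(\log_2(\sqrt{2d}-1)\bigr)^2}.$$ (3) For every $B\ge 2$, every $d\ge 1$, and every online algorithm $\mathrm{ALG}$, there is an instance $\mathcal I$ with $\mathrm{OPT}(\mathcal I)=2$ and $$\frac{\mathrm{ALG}(\mathcal I)}{\mathrm{OPT}(\mathcal I)} > \frac{\bigl((B+1)!\cdot d\bigr)^{1/(B+1)}-1}{2B}.$$ -/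

import Mathlib

namespace OVBP

/-- An item: a vector of `{0,1}^d`. An (online) instance is the list of its items in their order of
arrival; equal vectors at different places of the list are different items. -/
abbrev Item (d : ℕ) : Type := Fin d → Fin 2

/-- A list of items, each with the label of the bin that it is put into: an assignment of the items
to bins. The bins are the classes of items with the same label. -/
abbrev Assignment (d : ℕ) : Type := List (Item d × ℕ)

/-- The `j`-th coordinate of the sum of the vectors in the bin with label `b`. -/
def load {d : ℕ} (s : Assignment d) (b : ℕ) (j : Fin d) : ℕ :=
  ((s.filter (fun p => p.2 = b)).map (fun p => (p.1 j : ℕ))).sum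

/-- Every bin is feasible: its vectors sum up to at most `(B, …, B)`. -/
def Feasible {d : ℕ} (B : ℕ) (s : Assignment d) : Prop :=
  ∀ (b : ℕ) (j : Fin d), load s b j ≤ B

/-- The number of (nonempty) bins of an assignment. -/
def numBins {d : ℕ} (s : Assignment d) : ℕ :=
  (s.map Prod.snd).toFinset.card

/-- The minimum number of bins in a feasible packing of the instance `I`, with bin size `B`. -/
noncomputable def OPT {d : ℕ} (B : ℕ) (I : List (Item d)) : ℕ :=
  sInf {m : ℕ | ∃ s : Assignment d, s.map Prod.fst = I ∧ Feasible B s ∧ numBins s = m}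

/-- The assignment produced when the items of `I` arrive one by one and the rule `f` selects the
bin of each new item from the previous items, their bins, and the new item. -/
def run {d : ℕ} (f : Assignment d → Item d → ℕ) (I : List (Item d)) : Assignment d :=
  I.foldl (fun s v => s ++ [(v, f s v)]) []

/-- A deterministic online algorithm for `{0,1}` `d`-dimensional vector bin packing with bin size
`B`: each new item is irrevocably assigned to a bin that depends only on what has happened so far
and on the item, and all the bins are feasible at all times, on every instance. -/
structure OnlineAlgorithm (d B : ℕ) where
  rule : Assignment d → Item d → ℕ
  feasible : ∀ I : List (Item d), Feasible B (run rule I)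

/-- The number of bins that the algorithm `A` uses on the instance `I`. -/
def OnlineAlgorithm.cost {d B : ℕ} (A : OnlineAlgorithm d B) (I : List (Item d)) : ℕ :=
  numBins (run A.rule I)

/-- The competitive ratio of the algorithm `A` on the instance `I`. -/
noncomputable def OnlineAlgorithm.ratio {d B : ℕ} (A : OnlineAlgorithm d B) (I : List (Item d)) :
    ℝ :=
  (A.cost I : ℝ) / (OPT B I : ℝ)

/-- The first bin, in the order `0, 1, 2, …`, that can accommodate `v`. Bins that have not been
opened are empty, so this is the next new bin if none of the opened bins can accommodate `v`. -/
noncomputable def firstFitRule {d : ℕ} (B : ℕ) (s : Assignment d) (v : Item d) : ℕ :=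
  sInf {b : ℕ | ∀ j : Fin d, load s b j + (v j : ℕ) ≤ B}

theorem load_append_single {d : ℕ} (s : Assignment d) (v : Item d) (c b : ℕ) (j : Fin d) :
    load (s ++ [(v, c)]) b j = load s b j + if c = b then (v j : ℕ) else 0 := by
  by_cases h : c = b <;> simp [load, List.filter_append, h]

theorem firstFitRule_spec {d B : ℕ} (hB : 1 ≤ B) (s : Assignment d) (v : Item d) (j : Fin d) :
    load s (firstFitRule B s v) j + (v j : ℕ) ≤ B := by
  have hne : {b : ℕ | ∀ j : Fin d, load s b j + (v j : ℕ) ≤ B}.Nonempty := by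
    obtain ⟨b, hb⟩ := Infinite.exists_notMem_finset (s.map Prod.snd).toFinset
    refine ⟨b, fun j => ?_⟩
    have h0 : s.filter (fun p => p.2 = b) = [] := by
      rw [List.filter_eq_nil_iff]
      intro p hp hpb
      simp only [decide_eq_true_eq] at hpb
      exact hb (List.mem_toFinset.2 (List.mem_map.2 ⟨p, hp, hpb⟩))
    have h1 : load s b j = 0 := by simp [load, h0]
    have h2 := (v j).isLt
    omega
  exact Nat.sInf_mem hne j

/-- The algorithm FirstFit. -/
noncomputable def firstFit (d B : ℕ) (hB : 1 ≤ B) : OnlineAlgorithm d B where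
  rule := firstFitRule B
  feasible := by
    intro I
    induction I using List.reverseRecOn with
    | nil => intro b j; simp [run, load]
    | append_singleton I v ih =>
      intro b j
      have hr : run (firstFitRule B) (I ++ [v]) = run (firstFitRule B) I ++
          [(v, firstFitRule B (run (firstFitRule B) I) v)] := by
        simp [run, List.foldl_append]
      rw [hr, load_append_single]
      split_ifs with h
      · subst h
        exact firstFitRule_spec hB _ v j
      · simpa using ih b j

end OVBP

/-! A coordinate labelled by `B + 1` items, with ones at all of them, forbids that they share a bin.
So `d` coordinates suffice to control all `(B + 1)`-subsets of `n` items as long as `n.choose (B +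
1) ≤ d`. For `B = 1` the items are the vertices of a graph, each coordinate is a potential edge, and
packing is proper colouring.

FirstFit (`exists_crown_instance`): the crown graph, complete bipartite minus a perfect matching, is
2-colourable, but if the matched pairs arrive one after another, FirstFit gives each pair its own
bin.

Bin size 1 (`exists_instance_bin_size_one`): the adversary keeps a hidden proper colouring with `2 *
p + 2` colours. Each new item gets a set of at most `p + 1` admissible colours that is not the
colour set of any bin, and conflicts with all earlier items of other colours. The bin chosen for it
then has a colour set strictly inside the admissible set, so the item can take a colour new to that
bin. Hence a bin never holds more than `p + 1` items. A suitable set exists while there are fewer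
than `(2 * p + 2) * 4 ^ p` items.

Bin size at least 2 (`exists_instance_of_two_le`): the last item of a `(B + 1)`-set completes its
conflict exactly when the other items share a bin, apart from one set whose conflict is always
present. So the algorithm never puts more than `B` items into a bin, while every set that conflicts,
except that one, contains a full bin. Two colours that split every bin with at least two items
therefore give a feasible packing. -/

namespace OVBP

/-! ### Assignments indexed by time, runs and bounds on `OPT` -/

/-- The assignment that puts the items `v 0, …, v (n - 1)` into the bins `β 0, …, β (n - 1)`. -/
def assignmentOf {d : ℕ} (n : ℕ) (v : ℕ → Item d) (β : ℕ → ℕ) : Assignment d :=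
  (List.range n).map fun t => (v t, β t)

/-- Records an adaptive game as one infinite sequence: `R l a` says that `a` is a legal next move
after the history `l`. -/
theorem exists_seq_of_prefix {α : Type*} {R : List α → α → Prop} (h : ∀ l, ∃ a, R l a) :
    ∃ g : ℕ → α, ∀ t, R ((List.range t).map g) (g t) := by
  choose step hstep using h
  let L : ℕ → List α := fun t => Nat.rec [] (fun _ l => l ++ [step l]) t
  have hL : ∀ t, (List.range t).map (fun i => step (L i)) = L t := by
    intro t
    induction t with
    | zero => rfl
    | succ t ih => rw [List.range_succ, List.map_append, ih]; rfl
  exact ⟨fun i => step (L i), fun t => by rw [hL]; exact hstep _⟩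

section Basic

variable {d : ℕ} {B : ℕ}

theorem map_fst_assignmentOf (n : ℕ) (v : ℕ → Item d) (β : ℕ → ℕ) :
    (assignmentOf n v β).map Prod.fst = (List.range n).map v := by
  simp [assignmentOf]

theorem numBins_assignmentOf (n : ℕ) (v : ℕ → Item d) (β : ℕ → ℕ) :
    numBins (assignmentOf n v β) = ((Finset.range n).image β).card := by
  unfold numBins assignmentOf
  congr 1
  ext b
  simp

theorem load_assignmentOf (n : ℕ) (v : ℕ → Item d) (β : ℕ → ℕ) (b : ℕ) (j : Fin d) :
    load (assignmentOf n v β) b j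
      = ((Finset.range n).filter fun t => β t = b ∧ v t j = 1).card := by
  induction n with
  | zero => simp [assignmentOf, load]
  | succ n ih =>
    have h : assignmentOf (n + 1) v β = assignmentOf n v β ++ [(v n, β n)] := by
      simp [assignmentOf, List.range_succ]
    have hv : v n j = 0 ∨ v n j = 1 := by omega
    rw [h, load_append_single, ih, Finset.range_add_one, Finset.filter_insert]
    rcases hv with hv | hv <;> by_cases hb : β n = b <;> simp [hv, hb]

/-- By determinism, answers collected against an adaptive adversary are the run on the finished
list, so adaptivity costs nothing. -/
theorem run_map_range {f : Assignment d → Item d → ℕ} {v : ℕ → Item d} {β : ℕ → ℕ} (n : ℕ)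
    (h : ∀ t < n, β t = f (assignmentOf t v β) (v t)) :
    run f ((List.range n).map v) = assignmentOf n v β := by
  induction n with
  | zero => rfl
  | succ n ih =>
    have ih' := ih fun t ht => h t (ht.trans n.lt_succ_self)
    have e : run f ((List.range (n + 1)).map v) = run f ((List.range n).map v)
        ++ [(v n, f (run f ((List.range n).map v)) (v n))] := by
      simp [run, List.range_succ, List.foldl_append]
    rw [e, ih', ← h n n.lt_succ_self]
    simp [assignmentOf, List.range_succ]

theorem map_fst_run (f : Assignment d → Item d → ℕ) (I : List (Item d)) :
    (run f I).map Prod.fst = I := by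
  induction I using List.reverseRecOn with
  | nil => rfl
  | append_singleton I v ih =>
    have e : run f (I ++ [v]) = run f I ++ [(v, f (run f I) v)] := by
      simp [run, List.foldl_append]
    rw [e, List.map_append, ih]
    rfl

theorem OPT_le {I : List (Item d)} {s : Assignment d} (hs : s.map Prod.fst = I)
    (hf : Feasible B s) : OPT B I ≤ numBins s :=
  Nat.sInf_le ⟨s, hs, hf, rfl⟩

theorem OnlineAlgorithm.OPT_le_cost (A : OnlineAlgorithm d B) (I : List (Item d)) :
    OPT B I ≤ A.cost I :=
  OPT_le (map_fst_run _ _) (A.feasible I)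

theorem exists_packing_of_feasible {I : List (Item d)} {s : Assignment d}
    (hs : s.map Prod.fst = I) (hf : Feasible B s) :
    ∃ s' : Assignment d, s'.map Prod.fst = I ∧ Feasible B s' ∧ numBins s' = OPT B I :=
  Nat.sInf_mem (s := {m | ∃ s : Assignment d, s.map Prod.fst = I ∧ Feasible B s ∧ numBins s = m})
    ⟨numBins s, s, hs, hf, rfl⟩

theorem OPT_pos {I : List (Item d)} {s : Assignment d} (hs : s.map Prod.fst = I)
    (hf : Feasible B s) (hI : I ≠ []) : 0 < OPT B I := by
  obtain ⟨s', hs', -, hn⟩ := exists_packing_of_feasible hs hf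
  rw [← hn, numBins, Finset.card_pos]
  cases s' with
  | nil => exact absurd hs'.symm hI
  | cons p s' => exact ⟨p.2, by simp⟩

/-- An instance whose items have more than `B` ones in some coordinate needs two bins. -/
theorem two_le_OPT {I : List (Item d)} {s : Assignment d} (hs : s.map Prod.fst = I)
    (hf : Feasible B s) {j : Fin d} (hj : B < (I.map fun v => (v j : ℕ)).sum) :
    2 ≤ OPT B I := by
  obtain ⟨s', hs', hf', hn⟩ := exists_packing_of_feasible hs hf
  by_contra hlt
  have h1 : (s'.map Prod.snd).toFinset.card ≤ 1 := by
    change numBins s' ≤ 1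
    omega
  obtain ⟨b, hb⟩ : ∃ b, ∀ p ∈ s', p.2 = b := by
    cases s' with
    | nil => exact ⟨0, by simp⟩
    | cons q s' =>
      refine ⟨q.2, fun p hp => Finset.card_le_one.1 h1 _ ?_ _ ?_⟩
      · exact List.mem_toFinset.2 (List.mem_map_of_mem hp)
      · simp
  have h2 := hf' b j
  have h3 : s'.filter (fun p => p.2 = b) = s' := by
    rw [List.filter_eq_self]
    simpa using hb
  rw [load, h3] at h2
  rw [← hs', List.map_map] at hj
  exact absurd h2 (not_le.2 hj)

theorem sum_map_range_coord (n : ℕ) (v : ℕ → Item d) (j : Fin d) :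
    (((List.range n).map v).map fun w => (w j : ℕ)).sum
      = ((Finset.range n).filter fun t => v t j = 1).card := by
  have h := load_assignmentOf n v (fun _ => 0) 0 j
  simpa [load, assignmentOf, List.filter_eq_self.2, Function.comp_def] using h

end Basic

/-! ### Coordinates as subsets of the items -/

/-- Coordinates can be labelled by the `r`-subsets of `{0, …, n - 1}`, each of them being used. -/
theorem exists_coord_labelling {d n r : ℕ} (hr : r ≤ n) (h : n.choose r ≤ d) :
    ∃ dec : Fin d → Finset ℕ, (∀ j, dec j ⊆ Finset.range n ∧ (dec j).card = r) ∧
      ∀ T ⊆ Finset.range n, T.card = r → ∃ j, dec j = T := by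
  classical
  let S := Finset.powersetCard r (Finset.range n)
  have hS : S.card = n.choose r := by simp [S]
  have : Nonempty S := by
    obtain ⟨x, hx⟩ := Finset.card_pos.1 (hS ▸ Nat.choose_pos hr)
    exact ⟨⟨x, hx⟩⟩
  obtain ⟨e⟩ : Nonempty (S ↪ Fin d) :=
    Function.Embedding.nonempty_of_card_le (by simpa [hS] using h)
  -- A surplus coordinate, outside the range of `e`, repeats the label of another one and so adds no
  -- new constraint.
  refine ⟨fun j => (Function.invFun e j : S), fun j => ?_, fun T hT hc => ?_⟩
  · exact Finset.mem_powersetCard.1 (Function.invFun e j).2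
  · refine ⟨e ⟨T, Finset.mem_powersetCard.2 ⟨hT, hc⟩⟩, ?_⟩
    dsimp only
    rw [Function.leftInverse_invFun e.injective]

/-- The largest `n` with `n.choose r ≤ d`. -/
theorem exists_choose_le_lt {r d : ℕ} (hr : 1 ≤ r) (hd : 1 ≤ d) :
    ∃ n, r ≤ n ∧ n.choose r ≤ d ∧ d < (n + 1).choose r := by
  have hex : ∃ N, d < (N + r).choose r := by
    refine ⟨d, ?_⟩
    calc d < (d + 1).choose 1 := by simp
      _ = (d + 1).choose d := by rw [Nat.choose_symm_add]
      _ ≤ (d + r).choose d := Nat.choose_le_choose _ (by omega)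
      _ = (d + r).choose r := by rw [Nat.choose_symm_add]
  classical
  have h1 := Nat.find_spec hex
  have h0 : Nat.find hex ≠ 0 := by
    intro h
    rw [h] at h1
    simp at h1
    omega
  obtain ⟨N, hN⟩ := Nat.exists_eq_succ_of_ne_zero h0
  have h2 := Nat.find_min hex (m := N) (by omega)
  refine ⟨N + r, by omega, not_lt.1 h2, ?_⟩
  rw [hN] at h1
  rwa [show N + r + 1 = N.succ + r by omega]

/-! ### Bin size at least 2, any online algorithm -/

/-- The adversary for `B ≥ 2`: coordinates are the `(B + 1)`-subsets of `{0, …, n - 1}`, and the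
last item of such a set gets a one there if the other items of the set share a bin. -/
theorem exists_adversary_full_bins {d B : ℕ} (dec : Fin d → Finset ℕ) (A : OnlineAlgorithm d B) :
    ∃ (v : ℕ → Item d) (β : ℕ → ℕ), (∀ t, β t = A.rule (assignmentOf t v β) (v t)) ∧
      ∀ t j, v t j = 1 ↔ t ∈ dec j ∧ (dec j = Finset.range (B + 1) ∨ (∃ u ∈ dec j, t < u) ∨
        ∃ b, ∀ u ∈ dec j, u < t → β u = b) := by
  classical
  -- The history has length equal to the current time; the default of `getD` is never read, as only
  -- `u < l.length` occur.
  obtain ⟨g, hg⟩ := exists_seq_of_prefix (α := Item d × ℕ) (R := fun l a =>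
    a.2 = A.rule l a.1 ∧ ∀ j, a.1 j = 1 ↔ l.length ∈ dec j ∧ (dec j = Finset.range (B + 1) ∨
      (∃ u ∈ dec j, l.length < u) ∨
        ∃ b, ∀ u ∈ dec j, u < l.length → (l.map Prod.snd).getD u 0 = b)) (by
    intro l
    let w : Item d := fun j => if l.length ∈ dec j ∧ (dec j = Finset.range (B + 1) ∨
      (∃ u ∈ dec j, l.length < u) ∨
        ∃ b, ∀ u ∈ dec j, u < l.length → (l.map Prod.snd).getD u 0 = b) then 1 else 0
    refine ⟨(w, A.rule l w), rfl, fun j => ?_⟩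
    simp only [w]
    split_ifs with h
    · exact ⟨fun _ => h, fun _ => rfl⟩
    · exact ⟨fun h' => absurd h' (by decide), fun h' => absurd h' h⟩)
  refine ⟨fun t => (g t).1, fun t => (g t).2, fun t => (hg t).1, fun t j => ?_⟩
  rw [(hg t).2 j]
  have key : ∀ u < t, (((List.range t).map g).map Prod.snd).getD u 0 = (g u).2 := by
    intro u hu
    simp [List.getD, hu]
  simp only [List.length_map, List.length_range]
  refine and_congr_right fun _ => or_congr_right (or_congr_right ?_)
  refine exists_congr fun b => forall₂_congr fun u _ => forall_congr' fun hu => ?_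
  rw [key u hu]

/-- For any assignment to bins there is a 2-colouring that separates `0` and `1` and such that no
bin with a second element is monochromatic. -/
theorem exists_two_coloring (β : ℕ → ℕ) :
    ∃ c : ℕ → ℕ, (∀ t, c t < 2) ∧ c 0 ≠ c 1 ∧
      ∀ x y, x < y → β x = β y → (∀ u < x, β u ≠ β x) → c x ≠ c y := by
  classical
  -- The colour is basically `p`, which sets the first item of a bin apart from the others. If `0`
  -- and `1` lie in different bins, both are first, so `q` swaps the colours in the bin of `1`.
  let p : ℕ → Prop := fun t => ∃ u < t, β u = β t
  let q : ℕ → Prop := fun t => β t = β 1 ∧ β 1 ≠ β 0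
  refine ⟨fun t => if (p t ↔ q t) then 0 else 1, fun t => ?_, ?_, ?_⟩
  · dsimp only
    split_ifs <;> omega
  · have hp0 : ¬ p 0 := by simp [p]
    have hp1 : p 1 ↔ β 0 = β 1 := by simp [p]
    have hq0 : ¬ q 0 := fun h => h.2 h.1.symm
    have hq1 : q 1 ↔ β 1 ≠ β 0 := by simp [q]
    by_cases h : β 0 = β 1
    · simp [hp0, hp1, hq0, hq1, h]
    · simp [hp0, hp1, hq0, hq1, h, Ne.symm h]
  · intro x y hxy hb hfirst
    have hpx : ¬ p x := fun ⟨u, hu, h⟩ => hfirst u hu h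
    have hpy : p y := ⟨x, hxy, hb⟩
    have hq : q x ↔ q y := by simp [q, hb]
    by_cases h : q y <;> simp [hpx, hpy, hq, h]

/-- `B + 1` items in one bin would all have a one at the coordinate of their set, so every bin has
at most `B` items. The packing in two bins comes from `exists_two_coloring`, and the coordinate of
`Finset.range (B + 1)` rules out a single bin. -/
theorem exists_instance_of_two_le {d B n : ℕ} (hB : 2 ≤ B) (hn : B + 1 ≤ n)
    (hd : n.choose (B + 1) ≤ d) (A : OnlineAlgorithm d B) :
    ∃ I : List (Item d), OPT B I = 2 ∧ n ≤ B * A.cost I := by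
  obtain ⟨dec, hdec, hsurj⟩ := exists_coord_labelling hn hd
  obtain ⟨v, β, hβ, hv⟩ := exists_adversary_full_bins dec A
  have hrun := run_map_range n fun t _ => hβ t
  have hfeas : Feasible B (assignmentOf n v β) := hrun ▸ A.feasible _
  have hmem : ∀ t j, v t j = 1 → t ∈ dec j := fun t j h => ((hv t j).1 h).1
  have hbin : ∀ b, ((Finset.range n).filter fun t => β t = b).card ≤ B := by
    intro b
    by_contra hlt
    obtain ⟨T, hT, hTc⟩ := Finset.exists_subset_card_eq (Nat.succ_le_of_lt (not_le.1 hlt))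
    have hTb : ∀ t ∈ T, t < n ∧ β t = b := fun t ht => by simpa using hT ht
    obtain ⟨j, rfl⟩ := hsurj T (fun t ht => by simpa using (hTb t ht).1) hTc
    have h := hfeas b j
    rw [load_assignmentOf] at h
    have hsub : dec j ⊆ (Finset.range n).filter fun t => β t = b ∧ v t j = 1 := by
      intro t ht
      simp only [Finset.mem_filter, Finset.mem_range]
      exact ⟨(hTb t ht).1, (hTb t ht).2,
        (hv t j).2 ⟨ht, .inr (.inr ⟨b, fun u hu _ => (hTb u hu).2⟩)⟩⟩
    have := Finset.card_le_card hsub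
    omega
  obtain ⟨c, hc2, hc01, hc⟩ := exists_two_coloring β
  have hcf : Feasible B (assignmentOf n v c) := by
    intro a j
    rw [load_assignmentOf]
    by_contra hlt
    have hsub : ((Finset.range n).filter fun t => c t = a ∧ v t j = 1) ⊆ dec j := by
      intro t ht
      simp only [Finset.mem_filter] at ht
      exact hmem t j ht.2.2
    -- Overload at `j` requires all `B + 1` items of `dec j` to have a one there and the same
    -- colour; the reason why the last of them has a one is then contradicted.
    have heq := Finset.eq_of_subset_of_card_le hsub (by rw [(hdec j).2]; omega)
    have hall : ∀ t ∈ dec j, c t = a ∧ v t j = 1 := by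
      intro t ht
      rw [← heq] at ht
      exact (Finset.mem_filter.1 ht).2
    have hne : (dec j).Nonempty := Finset.card_pos.1 (by rw [(hdec j).2]; omega)
    have hmax := (dec j).max'_mem hne
    rcases ((hv _ j).1 (hall _ hmax).2).2 with h | ⟨u, hu, hlt'⟩ | ⟨b, hb⟩
    · have h0 : 0 ∈ dec j := by rw [h]; simp
      have h1 : 1 ∈ dec j := by rw [h]; simp; omega
      exact hc01 ((hall 0 h0).1.trans (hall 1 h1).1.symm)
    · exact absurd ((dec j).le_max' u hu) (not_le.2 hlt')
    · set q := (dec j).max' hne with hq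
      have hTc : ((dec j).erase q).card = B := by
        rw [Finset.card_erase_of_mem hmax, (hdec j).2, Nat.add_sub_cancel]
      have hTb : ∀ t ∈ (dec j).erase q, β t = b := by
        intro t ht
        have ht' := Finset.mem_erase.1 ht
        exact hb t ht'.2 (lt_of_le_of_ne ((dec j).le_max' t ht'.2) ht'.1)
      have hTsub : (dec j).erase q ⊆ (Finset.range n).filter fun t => β t = b := by
        intro t ht
        exact Finset.mem_filter.2 ⟨(hdec j).1 (Finset.mem_of_mem_erase ht), hTb t ht⟩
      -- The other `B` items fill the bin `b`, so their minimum `z` is the first item of that bin.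
      -- Since `B ≥ 2`, there is a second one, of the other colour.
      have hTeq := Finset.eq_of_subset_of_card_le hTsub (by rw [hTc]; exact hbin b)
      obtain ⟨x, hx, y, hy, hxy⟩ := Finset.one_lt_card.1 (show 1 < ((dec j).erase q).card by omega)
      have hTne : ((dec j).erase q).Nonempty := ⟨x, hx⟩
      have hmin := ((dec j).erase q).min'_mem hTne
      set z := ((dec j).erase q).min' hTne with hz
      obtain ⟨y, hy, hzy⟩ : ∃ y ∈ (dec j).erase q, z < y := by
        by_cases hxz : x = z
        · exact ⟨y, hy, lt_of_le_of_ne (Finset.min'_le _ y hy) (hxz ▸ hxy)⟩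
        · exact ⟨x, hx, lt_of_le_of_ne (Finset.min'_le _ x hx) (Ne.symm hxz)⟩
      refine hc z y hzy ((hTb z hmin).trans (hTb y hy).symm) ?_ ?_
      · intro u hu hub
        have hzn := Finset.mem_range.1 ((hdec j).1 (Finset.mem_of_mem_erase hmin))
        have : u ∈ (dec j).erase q := by
          rw [hTeq]
          exact Finset.mem_filter.2 ⟨Finset.mem_range.2 (hu.trans hzn), hub.trans (hTb z hmin)⟩
        exact absurd (Finset.min'_le _ u this) (not_le.2 hu)
      · exact (hall z (Finset.mem_of_mem_erase hmin)).1.trans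
          (hall y (Finset.mem_of_mem_erase hy)).1.symm
  refine ⟨(List.range n).map v, le_antisymm ?_ ?_, ?_⟩
  · refine (OPT_le (map_fst_assignmentOf n v c) hcf).trans ?_
    rw [numBins_assignmentOf]
    refine (Finset.card_le_card (t := Finset.range 2) ?_).trans (by simp)
    intro a ha
    obtain ⟨t, -, rfl⟩ := Finset.mem_image.1 ha
    exact Finset.mem_range.2 (hc2 t)
  · obtain ⟨j, hj⟩ := hsurj (Finset.range (B + 1)) (Finset.range_subset_range.2 hn) (by simp)
    refine two_le_OPT (map_fst_assignmentOf n v c) hcf (j := j) ?_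
    rw [sum_map_range_coord]
    have hsub : Finset.range (B + 1) ⊆ (Finset.range n).filter fun t => v t j = 1 := by
      intro t ht
      refine Finset.mem_filter.2 ⟨Finset.range_subset_range.2 hn ht, ?_⟩
      exact (hv t j).2 ⟨hj ▸ ht, .inl hj⟩
    have := Finset.card_le_card hsub
    rw [Finset.card_range] at this
    omega
  · rw [OnlineAlgorithm.cost, hrun, numBins_assignmentOf]
    have := Finset.card_le_mul_card_image (f := β) (Finset.range n) B fun b _ => hbin b
    simpa using this

theorem exists_instance_ratio_of_two_le {d B : ℕ} (hd : 1 ≤ d) (hB : 2 ≤ B)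
    (A : OnlineAlgorithm d B) :
    ∃ I : List (Item d), OPT B I = 2 ∧
      A.ratio I > ((((Nat.factorial (B + 1) : ℕ) : ℝ) * (d : ℝ)) ^ ((1 : ℝ) / ((B : ℝ) + 1)) - 1) /
        (2 * (B : ℝ)) := by
  obtain ⟨n, hn, hnd, hdn⟩ := exists_choose_le_lt (r := B + 1) (by omega) hd
  obtain ⟨I, hI, hcost⟩ := exists_instance_of_two_le hB hn hnd A
  refine ⟨I, hI, ?_⟩
  have h1 : (B + 1).factorial * d < (n + 1) ^ (B + 1) := by
    calc (B + 1).factorial * d < (B + 1).factorial * (n + 1).choose (B + 1) :=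
          Nat.mul_lt_mul_of_pos_left hdn (Nat.factorial_pos _)
      _ = (n + 1).descFactorial (B + 1) := (Nat.descFactorial_eq_factorial_mul_choose _ _).symm
      _ ≤ (n + 1) ^ (B + 1) := Nat.descFactorial_le_pow _ _
  have h2 : (((Nat.factorial (B + 1) : ℕ) : ℝ) * (d : ℝ)) ^ ((1 : ℝ) / ((B : ℝ) + 1)) < n + 1 := by
    have h3 : ((Nat.factorial (B + 1) : ℕ) : ℝ) * (d : ℝ) < ((n : ℝ) + 1) ^ (B + 1) := by
      exact_mod_cast h1
    have h4 := Real.rpow_lt_rpow (by positivity) h3 (z := (1 : ℝ) / ((B : ℝ) + 1)) (by positivity)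
    have h5 : (((n : ℝ) + 1) ^ (B + 1)) ^ ((1 : ℝ) / ((B : ℝ) + 1)) = n + 1 := by
      have := Real.pow_rpow_inv_natCast (x := (n : ℝ) + 1) (by positivity) (Nat.succ_ne_zero B)
      rw [one_div]
      exact_mod_cast this
    rwa [h5] at h4
  have hB0 : (0 : ℝ) < B := by exact_mod_cast (by omega : 0 < B)
  have hc : (n : ℝ) ≤ B * A.cost I := by exact_mod_cast hcost
  rw [OnlineAlgorithm.ratio, hI, gt_iff_lt, div_lt_div_iff₀ (by positivity) (by norm_num)]
  push_cast
  nlinarith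

/-! ### Bin size 1, any online algorithm -/

/-- Over the subsets of `Fin (2 p + 2)` with at most half of the elements, the cardinalities sum
up to `(2 p + 2) 4 ^ p`. -/
theorem sum_card_small_subsets (p : ℕ) :
    ∑ s ∈ (Finset.univ : Finset (Finset (Fin (2 * p + 2)))) with s.card ≤ p + 1, s.card
      = (2 * p + 2) * 4 ^ p := by
  rw [Finset.sum_filter, ← Finset.powerset_univ,
    Finset.sum_powerset_apply_card (fun j => if j ≤ p + 1 then j else 0)]
  simp only [Finset.card_univ, Fintype.card_fin, smul_eq_mul, mul_ite, mul_zero]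
  rw [← Finset.sum_filter]
  have h1 : (Finset.range (2 * p + 2 + 1)).filter (fun j => j ≤ p + 1) = Finset.range (p + 2) := by
    ext j
    simp only [Finset.mem_filter, Finset.mem_range]
    omega
  -- Absorption, `(j + 1) * (2p+2).choose (j+1) = (2p+2) * (2p+1).choose j`, reduces the sum to half
  -- of a row of odd index.
  rw [h1, Finset.sum_range_succ', mul_zero, add_zero, ← Nat.sum_range_choose_halfway p,
    Finset.mul_sum]
  refine Finset.sum_congr rfl fun j _ => ?_
  have := Nat.add_one_mul_choose_eq (2 * p + 1) j
  rw [← this]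

/-- The hidden colours used by the first `t` items in the bin `b`. -/
def hue {κ : Type*} [DecidableEq κ] (β : ℕ → ℕ) (c : ℕ → κ) (t b : ℕ) : Finset κ :=
  ((Finset.range t).filter fun u => β u = b).image c

theorem mem_hue {κ : Type*} [DecidableEq κ] {β : ℕ → ℕ} {c : ℕ → κ} {t b : ℕ} {x : κ} :
    x ∈ hue β c t b ↔ ∃ u < t, β u = b ∧ c u = x := by
  simp [hue, and_assoc]

/-- The adversary for `B = 1`: `S t` is the set of colours that are available for the item `t`,
which conflicts with all previous items of other colours. -/
theorem exists_adversary_coloring {d : ℕ} {κ : Type*} [DecidableEq κ] [Nonempty κ] (m : ℕ)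
    (dec : Fin d → Finset ℕ) (A : OnlineAlgorithm d 1) :
    ∃ (v : ℕ → Item d) (β : ℕ → ℕ) (c : ℕ → κ) (S : ℕ → Finset κ),
      (∀ t, β t = A.rule (assignmentOf t v β) (v t)) ∧
      (∀ t j, v t j = 1 ↔ t ∈ dec j ∧ ∀ u ∈ dec j, u < t → c u ∉ S t) ∧
      (∀ t, (∃ T : Finset κ, T.card ≤ m ∧ ∀ b, hue β c t b ≠ T) →
        (S t).card ≤ m ∧ ∀ b, hue β c t b ≠ S t) ∧
      ∀ t, (S t \ hue β c t (β t)).Nonempty → c t ∈ S t \ hue β c t (β t) := by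
  classical
  let bin : List ((Item d × ℕ) × κ) → ℕ → ℕ := fun l u => (l.map fun a => a.1.2).getD u 0
  let col : List ((Item d × ℕ) × κ) → ℕ → κ :=
    fun l u => (l.map fun a => a.2).getD u (Classical.arbitrary κ)
  obtain ⟨g, hg⟩ := exists_seq_of_prefix (α := ((Item d × ℕ) × κ) × Finset κ) (R := fun l' a =>
    let l := l'.map Prod.fst
    a.1.1.2 = A.rule (l.map Prod.fst) a.1.1.1 ∧
    (∀ j, a.1.1.1 j = 1 ↔ l.length ∈ dec j ∧ ∀ u ∈ dec j, u < l.length → col l u ∉ a.2) ∧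
    ((∃ T : Finset κ, T.card ≤ m ∧ ∀ b, hue (bin l) (col l) l.length b ≠ T) →
      a.2.card ≤ m ∧ ∀ b, hue (bin l) (col l) l.length b ≠ a.2) ∧
    ((a.2 \ hue (bin l) (col l) l.length a.1.1.2).Nonempty →
      a.1.2 ∈ a.2 \ hue (bin l) (col l) l.length a.1.1.2)) (by
    intro l'
    extract_lets l
    obtain ⟨S, hS⟩ : ∃ S : Finset κ,
        (∃ T : Finset κ, T.card ≤ m ∧ ∀ b, hue (bin l) (col l) l.length b ≠ T) →
        S.card ≤ m ∧ ∀ b, hue (bin l) (col l) l.length b ≠ S := by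
      by_cases h : ∃ T : Finset κ, T.card ≤ m ∧ ∀ b, hue (bin l) (col l) l.length b ≠ T
      · exact ⟨h.choose, fun _ => h.choose_spec⟩
      · exact ⟨∅, fun h' => absurd h' h⟩
    let w : Item d := fun j =>
      if l.length ∈ dec j ∧ ∀ u ∈ dec j, u < l.length → col l u ∉ S then 1 else 0
    -- The hidden colour is fixed only after the algorithm has answered: the vector `w` depends on
    -- `S` and on earlier colours alone.
    obtain ⟨x, hx⟩ : ∃ x : κ,
        (S \ hue (bin l) (col l) l.length (A.rule (l.map Prod.fst) w)).Nonempty →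
        x ∈ S \ hue (bin l) (col l) l.length (A.rule (l.map Prod.fst) w) := by
      by_cases h : (S \ hue (bin l) (col l) l.length (A.rule (l.map Prod.fst) w)).Nonempty
      · exact ⟨h.choose, fun _ => h.choose_spec⟩
      · exact ⟨Classical.arbitrary κ, fun h' => absurd h' h⟩
    refine ⟨(((w, _), x), S), rfl, fun j => ?_, hS, hx⟩
    simp only [w]
    split_ifs with h
    · exact ⟨fun _ => h, fun _ => rfl⟩
    · exact ⟨fun h' => absurd h' (by decide), fun h' => absurd h' h⟩)
  have hbin : ∀ t, ∀ u < t, bin (((List.range t).map g).map Prod.fst) u = (g u).1.1.2 := by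
    intro t u hu
    simp [bin, List.getD, hu]
  have hcol : ∀ t, ∀ u < t, col (((List.range t).map g).map Prod.fst) u = (g u).1.2 := by
    intro t u hu
    simp [col, List.getD, hu]
  have hhue : ∀ t b, hue (bin (((List.range t).map g).map Prod.fst))
      (col (((List.range t).map g).map Prod.fst)) t b
        = hue (fun u => (g u).1.1.2) (fun u => (g u).1.2) t b := by
    intro t b
    ext x
    simp only [mem_hue]
    refine exists_congr fun u => and_congr_right fun hu => ?_
    rw [hbin t u hu, hcol t u hu]
  refine ⟨fun t => (g t).1.1.1, fun t => (g t).1.1.2, fun t => (g t).1.2, fun t => (g t).2,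
    fun t => ?_, fun t j => ?_, fun t => ?_, fun t => ?_⟩
  · have := (hg t).1
    simpa [assignmentOf, Function.comp_def] using this
  · have := (hg t).2.1 j
    rw [this]
    simp only [List.length_map, List.length_range]
    refine and_congr_right fun _ => forall₂_congr fun u _ => forall_congr' fun hu => ?_
    rw [hcol t u hu]
  · have := (hg t).2.2.1
    simpa only [List.length_map, List.length_range, hhue] using this
  · have := (hg t).2.2.2
    simpa only [List.length_map, List.length_range, hhue] using this

/-- As long as there are few items, some small set of colours is not the hue of a bin. -/
theorem exists_ne_hue {p t : ℕ} (β : ℕ → ℕ) (c : ℕ → Fin (2 * p + 2))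
    (ht : t < (2 * p + 2) * 4 ^ p) :
    ∃ T : Finset (Fin (2 * p + 2)), T.card ≤ p + 1 ∧ ∀ b, hue β c t b ≠ T := by
  classical
  by_contra! hcon
  choose! bin hbin using hcon
  let F := (Finset.univ : Finset (Finset (Fin (2 * p + 2)))).filter fun s => s.card ≤ p + 1
  have hcard : (F.sigma fun s => s).card = (2 * p + 2) * 4 ^ p := by
    rw [Finset.card_sigma, sum_card_small_subsets]
  -- If every small set were the hue of a bin, distinct sets would have distinct bins, and each
  -- colour of each set would need an item of its own.
  have hle : (F.sigma fun s => s).card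
      ≤ ((Finset.range t).image fun u => (β u, c u)).card := by
    refine Finset.card_le_card_of_injOn (fun x => (bin x.1, x.2)) ?_ ?_
    · rintro ⟨s, x⟩ hx
      simp only [F, Finset.coe_sigma, Set.mem_sigma_iff, Finset.mem_coe, Finset.mem_filter,
        Finset.mem_univ, true_and] at hx
      have := hx.2
      rw [← hbin s hx.1, mem_hue] at this
      obtain ⟨u, hu, h1, h2⟩ := this
      simp only [Finset.coe_image, Set.mem_image, Finset.mem_coe, Finset.mem_range]
      exact ⟨u, hu, by rw [h1, h2]⟩
    · rintro ⟨s, x⟩ hx ⟨s', x'⟩ hx' heq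
      simp only [F, Finset.coe_sigma, Set.mem_sigma_iff, Finset.mem_coe, Finset.mem_filter,
        Finset.mem_univ, true_and] at hx hx'
      simp only [Prod.mk.injEq] at heq
      have : s = s' := by rw [← hbin s hx.1, heq.1, hbin s' hx'.1]
      subst this
      rw [heq.2]
  have := hle.trans Finset.card_image_le
  rw [hcard, Finset.card_range] at this
  omega

theorem exists_instance_bin_size_one {d n p : ℕ} (hn : 2 ≤ n) (hd : n.choose 2 ≤ d)
    (hnp : n ≤ (2 * p + 2) * 4 ^ p) (A : OnlineAlgorithm d 1) :
    ∃ I : List (Item d), 0 < OPT 1 I ∧ OPT 1 I ≤ 2 * p + 2 ∧ n ≤ (p + 1) * A.cost I := by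
  obtain ⟨dec, hdec, hsurj⟩ := exists_coord_labelling hn hd
  obtain ⟨v, β, c, S, hβ, hv, hS, hc⟩ :=
    exists_adversary_coloring (κ := Fin (2 * p + 2)) (p + 1) dec A
  have hrun := run_map_range n fun t _ => hβ t
  have hfeas : Feasible 1 (assignmentOf n v β) := hrun ▸ A.feasible _
  have hgood : ∀ t < n, (S t).card ≤ p + 1 ∧ hue β c t (β t) ⊆ S t ∧
      c t ∈ S t \ hue β c t (β t) := by
    intro t ht
    obtain ⟨h1, h2⟩ := hS t (exists_ne_hue β c (ht.trans_le hnp))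
    -- An item `u` of the chosen bin with a colour outside `S t` would have a one at the coordinate
    -- `{u, t}`, as would `t`; at `u` the condition on earlier items is vacuous.
    have h3 : hue β c t (β t) ⊆ S t := by
      intro x hx
      obtain ⟨u, hu, hub, rfl⟩ := mem_hue.1 hx
      by_contra hx'
      obtain ⟨j, hj⟩ := hsurj {u, t} (by
        intro w hw
        simp only [Finset.mem_insert, Finset.mem_singleton] at hw
        exact Finset.mem_range.2 (by omega)) (Finset.card_pair hu.ne)
      have h := hfeas (β t) j
      rw [load_assignmentOf] at h
      have hsub : ({u, t} : Finset ℕ)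
          ⊆ (Finset.range n).filter fun w => β w = β t ∧ v w j = 1 := by
        intro w hw
        simp only [Finset.mem_insert, Finset.mem_singleton] at hw
        simp only [Finset.mem_filter, Finset.mem_range, hv, hj, Finset.mem_insert,
          Finset.mem_singleton]
        rcases hw with rfl | rfl
        · refine ⟨hu.trans ht, hub, .inl rfl, ?_⟩
          rintro y (rfl | rfl) hy <;> omega
        · refine ⟨ht, rfl, .inr rfl, ?_⟩
          rintro y (rfl | rfl) hy
          · exact hx'
          · omega
      have := Finset.card_le_card hsub
      rw [Finset.card_pair hu.ne] at this
      omega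
    refine ⟨h1, h3, hc t (Finset.sdiff_nonempty.2 fun h => h2 (β t) (h3.antisymm h))⟩
  have hhue : ∀ t ≤ n, ∀ b, (hue β c t b).card ≤ p + 1 := by
    intro t
    induction t with
    | zero => intro _ b; simp [hue]
    | succ t ih =>
      intro ht b
      by_cases hb : β t = b
      · subst hb
        obtain ⟨h1, h2, h3⟩ := hgood t ht
        refine (Finset.card_le_card ?_).trans h1
        intro x hx
        obtain ⟨u, hu, hub, rfl⟩ := mem_hue.1 hx
        rcases Nat.lt_succ_iff_lt_or_eq.1 hu with hu | rfl
        · exact h2 (mem_hue.2 ⟨u, hu, hub, rfl⟩)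
        · exact (Finset.mem_sdiff.1 h3).1
      · refine (Finset.card_le_card ?_).trans (ih (by omega) b)
        intro x hx
        obtain ⟨u, hu, hub, rfl⟩ := mem_hue.1 hx
        rcases Nat.lt_succ_iff_lt_or_eq.1 hu with hu | rfl
        · exact mem_hue.2 ⟨u, hu, hub, rfl⟩
        · exact absurd hub hb
  have hne : ∀ u t, u < t → t < n → β u = β t → c u ≠ c t := by
    intro u t hut ht hb h
    exact (Finset.mem_sdiff.1 (hgood t ht).2.2).2 (mem_hue.2 ⟨u, hut, hb, h⟩)
  have hcf : Feasible 1 (assignmentOf n v fun t => (c t : ℕ)) := by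
    intro a j
    rw [load_assignmentOf, Finset.card_le_one]
    -- The hidden colouring is proper: `t` conflicts only with earlier items coloured outside `S t`,
    -- while its own colour lies in `S t`.
    have key : ∀ u t, u < t → t < n → (c u : ℕ) = c t → v u j = 1 → v t j = 1 → False := by
      intro u t hut ht hc' hu1 ht1
      have h1 := ((hv t j).1 ht1).2 u ((hv u j).1 hu1).1 hut
      rw [Fin.ext hc'] at h1
      exact h1 (Finset.mem_sdiff.1 (hgood t ht).2.2).1
    intro u hu t ht
    simp only [Finset.mem_filter, Finset.mem_range] at hu ht
    rcases lt_trichotomy u t with h | h | h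
    · exact (key u t h ht.1 (hu.2.1.trans ht.2.1.symm) hu.2.2 ht.2.2).elim
    · exact h
    · exact (key t u h hu.1 (ht.2.1.trans hu.2.1.symm) ht.2.2 hu.2.2).elim
  refine ⟨(List.range n).map v, ?_, ?_, ?_⟩
  · refine OPT_pos (map_fst_assignmentOf n v _) hcf ?_
    simp only [ne_eq, List.map_eq_nil_iff, List.range_eq_nil]
    omega
  · refine (OPT_le (map_fst_assignmentOf n v _) hcf).trans ?_
    rw [numBins_assignmentOf]
    refine (Finset.card_le_card (t := Finset.range (2 * p + 2)) ?_).trans (by simp)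
    intro a ha
    obtain ⟨t, -, rfl⟩ := Finset.mem_image.1 ha
    exact Finset.mem_range.2 (c t).isLt
  · rw [OnlineAlgorithm.cost, hrun, numBins_assignmentOf]
    have := Finset.card_le_mul_card_image (f := β) (Finset.range n) (p + 1) fun b _ => by
      refine le_trans (le_of_eq ?_) (hhue n le_rfl b)
      refine (Finset.card_image_of_injOn ?_).symm
      intro u hu t ht h
      simp only [Finset.coe_filter, Finset.mem_range, Set.mem_ofPred_eq] at hu ht
      rcases lt_trichotomy u t with h' | h' | h'
      · exact absurd h (hne u t h' ht.1 (hu.2.trans ht.2.symm))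
      · exact h'
      · exact absurd h.symm (hne t u h' hu.1 (ht.2.trans hu.2.symm))
    simpa using this

/-- With `r = √(2d)`, the choice `4 ^ (p + 1) ≤ r - 1 < 4 ^ (p + 2)` makes the number `2 * p + 2` of
colours at most `logb 2 (r - 1)`, and the largest `n` with `n.choose 2 ≤ d` satisfies `r - 1 < n ≤ r
+ 1`. -/
theorem exists_instance_ratio_bin_size_one {d : ℕ} (hd : (4 ^ 9 + 1) ^ 2 ≤ d)
    (A : OnlineAlgorithm d 1) :
    ∃ I : List (Item d),
      (OPT 1 I : ℝ) ≤ Real.logb 2 (Real.sqrt (2 * (d : ℝ)) + 1) ∧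
      A.ratio I > 2 * (Real.sqrt (2 * (d : ℝ)) - 1) /
        (Real.logb 2 (Real.sqrt (2 * (d : ℝ)) - 1)) ^ 2 := by
  set r := Real.sqrt (2 * (d : ℝ)) with hr
  have hr0 : 0 ≤ r := Real.sqrt_nonneg _
  have hr2 : r ^ 2 = 2 * d := Real.sq_sqrt (by positivity)
  have hd' : ((4 : ℝ) ^ 9 + 1) ^ 2 ≤ d := by exact_mod_cast hd
  have hr1 : (4 : ℝ) ^ 9 ≤ r - 1 := by
    have : (4 : ℝ) ^ 9 + 1 ≤ r := Real.le_sqrt_of_sq_le (by linarith [hd'])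
    linarith
  have hx1 : (1 : ℝ) ≤ r - 1 := le_trans (by norm_num) hr1
  obtain ⟨m, hm1, hm2⟩ := exists_nat_pow_near hx1 (show (1 : ℝ) < 4 by norm_num)
  have hm : 9 ≤ m := by
    have h : (4 : ℝ) ^ 9 < 4 ^ (m + 1) := hr1.trans_lt hm2
    have := (pow_lt_pow_iff_right₀ (show (1 : ℝ) < 4 by norm_num)).1 h
    omega
  obtain ⟨p, rfl⟩ : ∃ p, m = p + 1 := ⟨m - 1, by omega⟩
  obtain ⟨n, hn, hnd, hdn⟩ := exists_choose_le_lt (r := 2) (d := d) (by omega)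
    (le_trans (by norm_num) hd)
  have hnd' : (n : ℝ) * (n - 1) ≤ 2 * d := by
    have : ((n.choose 2 : ℕ) : ℝ) ≤ d := by exact_mod_cast hnd
    rw [Nat.cast_choose_two] at this
    linarith
  have hdn' : 2 * (d : ℝ) < (n + 1) * n := by
    have : (d : ℝ) < ((n + 1).choose 2 : ℕ) := by exact_mod_cast hdn
    rw [Nat.cast_choose_two] at this
    push_cast at this
    linarith
  have hn2 : (2 : ℝ) ≤ n := by exact_mod_cast hn
  have hrn : r - 1 < n := by nlinarith
  have hnr : (n : ℝ) ≤ r + 1 := by nlinarith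
  have hnp : n ≤ (2 * p + 2) * 4 ^ p := by
    have h1 : (n : ℝ) < 4 ^ (p + 1 + 1) + 2 := by linarith
    have h2 : n < 4 ^ (p + 1 + 1) + 2 := by exact_mod_cast h1
    -- This is where the exponent `9` comes from: `n < 16 * 4 ^ p + 2 ≤ 18 * 4 ^ p`, and `18 ≤ 2 * p
    -- + 2` means `p + 1 ≥ 9`.
    have h3 : 18 * 4 ^ p ≤ (2 * p + 2) * 4 ^ p := Nat.mul_le_mul_right _ (by omega)
    have h4 : 0 < 4 ^ p := by positivity
    rw [pow_succ, pow_succ] at h2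
    omega
  obtain ⟨I, hpos, hle, hcost⟩ := exists_instance_bin_size_one hn hnd hnp A
  have hlog : ((2 * p + 2 : ℕ) : ℝ) ≤ Real.logb 2 (r - 1) := by
    rw [Real.le_logb_iff_rpow_le (by norm_num) (by linarith), Real.rpow_natCast]
    calc (2 : ℝ) ^ (2 * p + 2) = 4 ^ (p + 1) := by
          rw [show 2 * p + 2 = 2 * (p + 1) by ring, pow_mul]; norm_num
      _ ≤ r - 1 := hm1
  have hle' : (OPT 1 I : ℝ) ≤ ((2 * p + 2 : ℕ) : ℝ) := by exact_mod_cast hle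
  have hpos' : (0 : ℝ) < OPT 1 I := by exact_mod_cast hpos
  refine ⟨I, (hle'.trans hlog).trans
    (Real.logb_le_logb_of_le (by norm_num) (by linarith) (by linarith)), ?_⟩
  have hc : (n : ℝ) ≤ (p + 1) * A.cost I := by exact_mod_cast hcost
  have hk : (0 : ℝ) < ((2 * p + 2 : ℕ) : ℝ) := by positivity
  calc 2 * (r - 1) / (Real.logb 2 (r - 1)) ^ 2
      ≤ 2 * (r - 1) / ((2 * p + 2 : ℕ) : ℝ) ^ 2 := by
        refine div_le_div_of_nonneg_left (by linarith) (by positivity) ?_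
        exact pow_le_pow_left₀ hk.le hlog 2
    _ < 2 * n / ((2 * p + 2 : ℕ) : ℝ) ^ 2 :=
        div_lt_div_of_pos_right (by linarith) (by positivity)
    _ ≤ A.cost I / ((2 * p + 2 : ℕ) : ℝ) := by
        rw [div_le_div_iff₀ (by positivity) hk]
        push_cast
        nlinarith [mul_le_mul_of_nonneg_right hc (show (0 : ℝ) ≤ 4 * (p + 1) by positivity)]
    _ ≤ A.cost I / OPT 1 I := div_le_div_of_nonneg_left (by positivity) hpos' hle'

/-! ### FirstFit on the crown graph -/

section Crown

variable {d : ℕ} (dec : Fin d → ℕ × ℕ)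

/-- The items of the crown graph, whose edges `a i — b j` (`i ≠ j`) are the coordinates. -/
def crownLeft (i : ℕ) : Item d := fun j => if (dec j).1 = i then 1 else 0

/-- The other side of the crown graph. -/
def crownRight (i : ℕ) : Item d := fun j => if (dec j).2 = i then 1 else 0

/-- The items of the crown graph with `k` pairs, labelled: `x i` for `a i` and `y i` for `b i`. -/
def crown (k : ℕ) (x y : ℕ → ℕ) : Assignment d :=
  (List.range k).flatMap fun i => [(crownLeft dec i, x i), (crownRight dec i, y i)]

theorem crown_succ (k : ℕ) (x y : ℕ → ℕ) :
    crown dec (k + 1) x y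
      = crown dec k x y ++ [(crownLeft dec k, x k)] ++ [(crownRight dec k, y k)] := by
  simp [crown, List.range_succ, List.flatMap_append]

theorem map_fst_crown (k : ℕ) (x y x' y' : ℕ → ℕ) :
    (crown dec k x y).map Prod.fst = (crown dec k x' y').map Prod.fst := by
  simp [crown, List.map_flatMap]

theorem coe_crownLeft (i : ℕ) (j : Fin d) :
    ((crownLeft dec i j : Fin 2) : ℕ) = if (dec j).1 = i then 1 else 0 := by
  unfold crownLeft
  split_ifs <;> rfl

theorem coe_crownRight (i : ℕ) (j : Fin d) :
    ((crownRight dec i j : Fin 2) : ℕ) = if (dec j).2 = i then 1 else 0 := by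
  unfold crownRight
  split_ifs <;> rfl

/-- The bins of FirstFit: one matched pair per bin. -/
theorem load_crown_pairs (k b : ℕ) (j : Fin d) :
    load (crown dec k id id) b j
      = if b < k then (if (dec j).1 = b then 1 else 0) + (if (dec j).2 = b then 1 else 0)
        else 0 := by
  induction k with
  | zero => simp [crown, load]
  | succ k ih =>
    rw [crown_succ, load_append_single, load_append_single, ih, coe_crownLeft, coe_crownRight]
    simp only [id]
    split_ifs <;> omega

/-- The optimal packing: the two sides of the bipartition. -/
theorem load_crown_sides (k b : ℕ) (j : Fin d) :
    load (crown dec k (fun _ => 0) fun _ => 1) b j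
      = if b = 0 then (if (dec j).1 < k then 1 else 0)
        else if b = 1 then (if (dec j).2 < k then 1 else 0) else 0 := by
  induction k with
  | zero => simp [crown, load]
  | succ k ih =>
    rw [crown_succ, load_append_single, load_append_single, ih, coe_crownLeft, coe_crownRight]
    split_ifs <;> omega

variable {dec}

/-- FirstFit packs `a i` and `b i` together, in a bin of their own. -/
theorem run_firstFit_crown {k : ℕ} (hne : ∀ j, (dec j).1 ≠ (dec j).2)
    (hsurj : ∀ a < k, ∀ b < k, a ≠ b → ∃ j, dec j = (a, b)) :
    run (firstFitRule 1) ((crown dec k id id).map Prod.fst) = crown dec k id id := by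
  have append : ∀ (I : List (Item d)) (w : Item d), run (firstFitRule 1) (I ++ [w])
      = run (firstFitRule 1) I ++ [(w, firstFitRule 1 (run (firstFitRule 1) I) w)] := by
    intro I w
    simp [run, List.foldl_append]
  have least : ∀ (s : Assignment d) (w : Item d) (m : ℕ),
      (∀ j, load s m j + (w j : ℕ) ≤ 1) → (∀ b < m, ∃ j, 1 < load s b j + (w j : ℕ)) →
      firstFitRule 1 s w = m := by
    intro s w m h1 h2
    refine le_antisymm (Nat.sInf_le h1) ?_
    by_contra hlt
    obtain ⟨j, hj⟩ := h2 _ (not_le.1 hlt)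
    exact absurd (firstFitRule_spec le_rfl s w j) (not_le.2 hj)
  suffices h : ∀ m ≤ k, run (firstFitRule 1) ((crown dec m id id).map Prod.fst)
      = crown dec m id id from h k le_rfl
  intro m
  induction m with
  | zero => intro _; rfl
  | succ m ih =>
    intro hm
    have hl : firstFitRule 1 (crown dec m id id) (crownLeft dec m) = m := by
      refine least _ _ _ (fun j => ?_) fun b hb => ?_
      · rw [load_crown_pairs, coe_crownLeft]
        split_ifs <;> omega
      -- Each earlier bin `b` contains the right vertex `b`, which is adjacent to the left vertex
      -- `m`; the right vertex `m` is treated symmetrically below.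
      · obtain ⟨j, hj⟩ := hsurj m (by omega) b (by omega) (by omega)
        refine ⟨j, ?_⟩
        rw [load_crown_pairs, coe_crownLeft, hj]
        simp [hb]
    have hr : firstFitRule 1 (crown dec m id id ++ [(crownLeft dec m, m)]) (crownRight dec m)
        = m := by
      refine least _ _ _ (fun j => ?_) fun b hb => ?_
      · have := hne j
        rw [load_append_single, load_crown_pairs, coe_crownLeft, coe_crownRight]
        split_ifs <;> omega
      · obtain ⟨j, hj⟩ := hsurj b (by omega) m (by omega) (by omega)
        refine ⟨j, ?_⟩
        rw [load_append_single, load_crown_pairs, coe_crownLeft, coe_crownRight, hj]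
        simp [hb]
    rw [crown_succ, List.map_append, List.map_append, List.map_singleton, List.map_singleton,
      append, append, ih (by omega), hl]
    simp only [id]
    rw [hr]

end Crown

theorem exists_crown_labelling {d k : ℕ} (hk : 2 ≤ k) (hd : k * (k - 1) ≤ d) :
    ∃ dec : Fin d → ℕ × ℕ, (∀ j, (dec j).1 < k ∧ (dec j).2 < k ∧ (dec j).1 ≠ (dec j).2) ∧
      ∀ a < k, ∀ b < k, a ≠ b → ∃ j, dec j = (a, b) := by
  classical
  let S := (Finset.range k).offDiag
  have hS : S.card = k * (k - 1) := by
    rw [Finset.offDiag_card, Finset.card_range, Nat.mul_sub_one]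
  have hne : Nonempty S := ⟨⟨(0, 1), by simp [S]; omega⟩⟩
  obtain ⟨e⟩ : Nonempty (S ↪ Fin d) :=
    Function.Embedding.nonempty_of_card_le (by simpa [hS] using hd)
  refine ⟨fun j => (Function.invFun e j : S), fun j => ?_, fun a ha b hb hab => ?_⟩
  · have := (Function.invFun e j).2
    simpa only [S, Finset.mem_offDiag, Finset.mem_range] using this
  · refine ⟨e ⟨(a, b), by simp [S, ha, hb, hab]⟩, ?_⟩
    dsimp only
    rw [Function.leftInverse_invFun e.injective]

theorem exists_crown_instance {d k : ℕ} (hk : 2 ≤ k) (hd : k * (k - 1) ≤ d) :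
    ∃ I : List (Item d), OPT 1 I = 2 ∧ k ≤ (firstFit d 1 le_rfl).cost I := by
  obtain ⟨dec, hdec, hsurj⟩ := exists_crown_labelling hk hd
  have hfst := map_fst_crown dec k (fun _ => 0) (fun _ => 1) id id
  have hf : Feasible 1 (crown dec k (fun _ => 0) fun _ => 1) := by
    intro b j
    rw [load_crown_sides]
    split_ifs <;> omega
  refine ⟨(crown dec k id id).map Prod.fst, le_antisymm ?_ ?_, ?_⟩
  · refine (OPT_le hfst hf).trans ?_
    refine (Finset.card_le_card (t := {0, 1}) ?_).trans Finset.card_le_two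
    intro b hb
    simp only [crown, List.mem_toFinset, List.mem_map, List.mem_flatMap] at hb
    obtain ⟨q, ⟨i, -, hq⟩, rfl⟩ := hb
    simp only [List.mem_cons, List.not_mem_nil, or_false] at hq
    rcases hq with rfl | rfl <;> simp
  · obtain ⟨j, hj⟩ := hsurj 0 (by omega) 1 (by omega) (by omega)
    refine two_le_OPT hfst hf (j := j) ?_
    -- The edge `(0, 1)` has a one at the left vertex `0` and one at the right vertex `1`, which
    -- appear once `m` exceeds `0` and `1`.
    suffices h : ∀ m, (((crown dec m id id).map Prod.fst).map fun w => (w j : ℕ)).sum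
        = (if 0 < m then 1 else 0) + if 1 < m then 1 else 0 by
      rw [h]
      split_ifs <;> omega
    intro m
    induction m with
    | zero => simp [crown]
    | succ m ih =>
      rw [crown_succ, List.map_append, List.map_append, List.map_append, List.map_append,
        List.sum_append, List.sum_append, ih]
      simp only [List.map_singleton, List.sum_singleton, coe_crownLeft, coe_crownRight, hj]
      split_ifs <;> omega
  · change k ≤ numBins (run (firstFitRule 1) ((crown dec k id id).map Prod.fst))
    rw [run_firstFit_crown (fun j => (hdec j).2.2) hsurj]
    calc k = (Finset.range k).card := (Finset.card_range k).symm
      _ ≤ numBins (crown dec k id id) := by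
        refine Finset.card_le_card fun i hi => ?_
        simp only [crown, List.mem_toFinset, List.mem_map, List.mem_flatMap, List.mem_range]
        exact ⟨(crownLeft dec i, i), ⟨i, Finset.mem_range.1 hi, by simp⟩, rfl⟩

/-- Two equal items with a one conflict. -/
theorem OPT_pair_ones (d : ℕ) (hd : 1 ≤ d) :
    OPT 1 [(fun _ => 1 : Item d), fun _ => 1] = 2 := by
  have hs : ([((fun _ => 1 : Item d), 0), (fun _ => 1, 1)] : Assignment d).map Prod.fst
      = [(fun _ => 1 : Item d), fun _ => 1] := rfl
  have hf : Feasible 1 ([((fun _ => 1 : Item d), 0), (fun _ => 1, 1)] : Assignment d) := by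
    intro b j
    rw [show ([((fun _ => 1 : Item d), 0), (fun _ => 1, 1)] : Assignment d)
      = [] ++ [((fun _ => 1 : Item d), 0)] ++ [(fun _ => 1, 1)] from rfl,
      load_append_single, load_append_single]
    simp only [load, List.filter_nil, List.map_nil, List.sum_nil, Fin.val_one]
    split_ifs <;> omega
  refine le_antisymm ((OPT_le hs hf).trans ?_) (two_le_OPT hs hf (j := ⟨0, hd⟩) ?_)
  · simp [numBins]
  · simp

theorem exists_instance_ratio_firstFit {d : ℕ} (hd : 1 ≤ d) :
    ∃ I : List (Item d), OPT 1 I = 2 ∧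
      (firstFit d 1 le_rfl).ratio I > (Real.sqrt (2 * (d : ℝ)) - 1) / 4 := by
  obtain ⟨k, hk1, hkd, hdk⟩ : ∃ k, 1 ≤ k ∧ k * (k - 1) ≤ d ∧ d < (k + 1) * k := by
    have hP : ∃ k, d < (k + 1) * k := ⟨d, by nlinarith⟩
    have hspec := Nat.find_spec hP
    have h0 : Nat.find hP ≠ 0 := by
      intro h
      simp [h] at hspec
    obtain ⟨m, hm⟩ := Nat.exists_eq_succ_of_ne_zero h0
    have hmin := Nat.find_min hP (m := m) (by omega)
    rw [hm] at hspec
    exact ⟨m + 1, by omega, by simpa using hmin, hspec⟩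
  obtain ⟨I, hI, hcost⟩ : ∃ I : List (Item d), OPT 1 I = 2 ∧
      k ≤ (firstFit d 1 le_rfl).cost I := by
    rcases Nat.lt_or_ge 1 k with h | h
    · exact exists_crown_instance h hkd
    -- For `k = 1` the crown has no edge and fits into one bin, so two identical items replace it.
    · refine ⟨_, OPT_pair_ones d hd, ?_⟩
      have := (firstFit d 1 le_rfl).OPT_le_cost [(fun _ => 1 : Item d), fun _ => 1]
      rw [OPT_pair_ones d hd] at this
      omega
  refine ⟨I, hI, ?_⟩
  have hc : (k : ℝ) ≤ (firstFit d 1 le_rfl).cost I := by exact_mod_cast hcost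
  have hdk' : (d : ℝ) < (k + 1) * k := by exact_mod_cast hdk
  have hk : (1 : ℝ) ≤ k := by exact_mod_cast hk1
  -- From `d < (k + 1) * k` one has `2 * d < (2 * k + 1) ^ 2`, with room to spare.
  have hsq : Real.sqrt (2 * (d : ℝ)) < 2 * k + 1 := by
    rw [Real.sqrt_lt' (by positivity)]
    nlinarith
  rw [OnlineAlgorithm.ratio, hI, gt_iff_lt, div_lt_div_iff₀ (by norm_num) (by norm_num)]
  push_cast
  linarith

end OVBP

theorem theorem2 :
    -- (1) FirstFit, bin size 1
    (∀ d : ℕ, 1 ≤ d →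
      ∃ I : List (OVBP.Item d),
        OVBP.OPT 1 I = 2 ∧
        (OVBP.firstFit d 1 le_rfl).ratio I > (Real.sqrt (2 * (d : ℝ)) - 1) / 4) ∧
    -- (2) every online algorithm, bin size 1
    (∃ d₀ : ℕ, ∀ d : ℕ, d₀ ≤ d →
      ∀ A : OVBP.OnlineAlgorithm d 1,
      ∃ I : List (OVBP.Item d),
        (OVBP.OPT 1 I : ℝ) ≤ Real.logb 2 (Real.sqrt (2 * (d : ℝ)) + 1) ∧
        A.ratio I > 2 * (Real.sqrt (2 * (d : ℝ)) - 1) /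
          (Real.logb 2 (Real.sqrt (2 * (d : ℝ)) - 1)) ^ 2) ∧
    -- (3) every online algorithm, bin size at least 2
    (∀ d B : ℕ, 1 ≤ d → 2 ≤ B →
      ∀ A : OVBP.OnlineAlgorithm d B,
      ∃ I : List (OVBP.Item d),
        OVBP.OPT B I = 2 ∧
        A.ratio I > ((((Nat.factorial (B + 1) : ℕ) : ℝ) * (d : ℝ)) ^ ((1 : ℝ) / ((B : ℝ) + 1)) - 1) /
          (2 * (B : ℝ))) := by
  refine ⟨fun d hd => OVBP.exists_instance_ratio_firstFit hd,
    ⟨(4 ^ 9 + 1) ^ 2, fun d hd A => OVBP.exists_instance_ratio_bin_size_one hd A⟩,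
    fun d B hd hB A => OVBP.exists_instance_ratio_of_two_le hd hB A⟩
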